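/- Let $t_0\in\mathbb R$ and let $\lambda,\mu,\nu:[t_0,+\infty)\to\mathbb R$ be continuous with $\lambda(t)>0$, $\mu(t)\ge 0$, $\nu(t)\ge 0$ for all $t\ge t_0$. Consider the Van der Pol type equation $$(\lambda(t)\varphi'(t))'+\mu(t)(\varphi(t)^2-1)\varphi'(t)+\nu(t)\varphi(t)=0. \qquad (*)$$ A solution of $(*)$ on an interval is a differentiable real function $\varphi$ on it such that $\lambda\varphi'$ is differentiable and $(*)$ holds there (derivatives at $t_0$ are one-sided). A function on $[t_0,+\infty)$ is called oscillatory if for every $T\ge t_0$ it takes both a positive and a negative value on $[T,+\infty)$. 1. For all real $a,b$ there is exactly one solution $\varphi_0$ of $(*)$ on $[t_0,+\infty)$ with $\varphi_0(t_0)=a$, $\varphi_0'(t_0)=b$. Moreover, for every $T>t_0$, each solution of $(*)$ on $[t_0,T)$ with the same initial values coincides with $\varphi_0$ on $[t_0,T)$. 2. Assume in addition the following two conditions. a°) $\displaystyle\int_{t_0}^{+\infty}\frac{d\tau}{\lambda(\tau)}=+\infty$, and for every $\varepsilon\ge 1$ $$\int_{t_0}^{+\infty}\frac{1}{\lambda(\tau)}\int_{t_0}^{\tau}\exp\Bigl\{-\int_s^{\tau}\frac{\mu(\xi)(\varepsilon^2-1)}{\lambda(\xi)}\,d\xi\Bigr\}\nu(s)\,ds\,d\tau=+\infty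 .$$ b°) There is $\varepsilon_0>0$ such that for every $0<\varepsilon\le\varepsilon_0$ the linear equation $$(\lambda(t)\varphi'(t))'+\mu(t)(\varepsilon^2-1)\varphi'(t)+\nu(t)\varphi(t)=0,\qquad t\ge t_0,$$ is oscillatory, i.e. each of its solutions on $[t_0,+\infty)$ that is not identically zero is oscillatory. Then for all $(a,b)\ne(0,0)$ the solution $\varphi_0$ is oscillatory. -/

import Mathlib

open Set Filter

/-- `φ` solves `(p(t,φ(t)) φ'(t))' + q(t,φ(t)) φ'(t) + r(t,φ(t)) φ(t) = 0` on the interval `I`.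
Derivatives are taken within `I` (one-sided at an endpoint belonging to `I`); the two functions
that get differentiated, `φ` and `t ↦ p(t,φ(t)) φ'(t)`, are required to be differentiable on `I`. -/
def IsSolutionOn (p q r : ℝ → ℝ → ℝ) (I : Set ℝ) (φ : ℝ → ℝ) : Prop :=
  DifferentiableOn ℝ φ I ∧
  DifferentiableOn ℝ (fun t => p t (φ t) * derivWithin φ I t) I ∧
  ∀ t ∈ I,
    derivWithin (fun s => p s (φ s) * derivWithin φ I s) I t
      + q t (φ t) * derivWithin φ I t + r t (φ t) * φ t = 0

/-- `φ` solves the initial value problem `φ(t₀) = a`, `φ'(t₀) = b` for the Van der Pol type equation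
`(λ φ')' + μ (φ² - 1) φ' + ν φ = 0` on the interval `I` (with left endpoint `t₀ ∈ I`). -/
def IsVdPSolutionOn (lam mu nu : ℝ → ℝ) (t₀ a b : ℝ) (I : Set ℝ) (φ : ℝ → ℝ) : Prop :=
  IsSolutionOn (fun t _ => lam t) (fun t w => mu t * (w ^ 2 - 1)) (fun t _ => nu t) I φ ∧
  φ t₀ = a ∧ derivWithin φ I t₀ = b

/-- `φ` changes sign on `S`. -/
def ChangesSignOn (φ : ℝ → ℝ) (S : Set ℝ) : Prop :=
  (∃ t ∈ S, φ t < 0) ∧ (∃ t ∈ S, 0 < φ t)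

/-- `φ`, a function on a half-line `[t₀, +∞)`, changes sign in every neighbourhood of `+∞`. -/
def IsOscillatory (φ : ℝ → ℝ) : Prop :=
  ∀ T : ℝ, ChangesSignOn φ (Ici T)

/-- The linear equation `(p φ')' + q φ' + r φ = 0`, `t ≥ t₀`, is oscillatory: each of its nontrivial
solutions on `[t₀, +∞)` is oscillatory. -/
def IsOscillatoryLinearEq (t₀ : ℝ) (p q r : ℝ → ℝ) : Prop :=
  ∀ φ : ℝ → ℝ, IsSolutionOn (fun t _ => p t) (fun t _ => q t) (fun t _ => r t) (Ici t₀) φ →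
    (∃ t ∈ Ici t₀, φ t ≠ 0) → IsOscillatory φ

/-- The divergence condition: `∫_{t₀}^{+∞} dτ / λ(τ) = +∞`, and for every `ε ≥ 1`
`∫_{t₀}^{+∞} (1 / λ(τ)) ∫_{t₀}^τ exp (- ∫_s^τ μ(ξ) (ε² - 1) / λ(ξ) dξ) ν(s) ds dτ = +∞`. -/
def DivergenceCondition (t₀ : ℝ) (lam mu nu : ℝ → ℝ) : Prop :=
  Tendsto (fun T : ℝ => ∫ τ in t₀..T, 1 / lam τ) atTop atTop ∧
  ∀ ε : ℝ, 1 ≤ ε →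
    Tendsto (fun T : ℝ => ∫ τ in t₀..T, 1 / lam τ *
      ∫ s in t₀..τ, Real.exp (-∫ ξ in s..τ, mu ξ * (ε ^ 2 - 1) / lam ξ) * nu s) atTop atTop

/-- The oscillation condition: for some `ε₀ > 0` and every `0 < ε ≤ ε₀` the linear equation
`(λ φ')' + μ (ε² - 1) φ' + ν φ = 0`, `t ≥ t₀`, is oscillatory. -/
def OscillationCondition (t₀ : ℝ) (lam mu nu : ℝ → ℝ) : Prop :=
  ∃ ε₀ : ℝ, 0 < ε₀ ∧ ∀ ε : ℝ, 0 < ε → ε ≤ ε₀ →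
    IsOscillatoryLinearEq t₀ lam (fun t => mu t * (ε ^ 2 - 1)) nu

/-! With y = λφ' the equation becomes a first-order system. The parameters κ = 1, c = -1 give the
nonlinear equation, κ = 0, c = ε² - 1 the linear ones, so both share one theory. The field is
locally Lipschitz, hence uniqueness in both time directions. Global existence comes from φ² + y²:
the only superlinear term, the damping κμφ²y/λ, pulls y towards 0 and can be dropped, so the energy
grows at most exponentially (`exists_growth_bound`).

For oscillation, suppose a nontrivial solution is eventually nonnegative. By backward uniqueness it
is then eventually positive (`pos_of_nonneg`). If y is ever negative, it stays so and φ decreases.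
Integrating factors then bound φ' above by a negative multiple of an integrand in the divergence
condition, forcing φ to -∞ (`false_of_pos_of_snd_neg`). Otherwise φ is nondecreasing, so φ ≥ ε for a
small ε, and a Picone-type comparison with the linear equation for that ε contradicts its
oscillation (`not_isOscillatory_of_nonneg`). The symmetry φ ↦ -φ handles the other sign. -/

/-- The vector field of `φ' = y / λ`, `y' = -μ (κ φ² + c) y / λ - ν φ`. -/
noncomputable def vdpField (lam mu nu : ℝ → ℝ) (κ c t : ℝ) (z : ℝ × ℝ) : ℝ × ℝ :=
  (z.2 / lam t, -(mu t * (κ * z.1 ^ 2 + c)) * (z.2 / lam t) - nu t * z.1)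

/-- `z = (φ, y)` is an integral curve of `vdpField` on `I`. -/
def IsVdPCurveOn (lam mu nu : ℝ → ℝ) (κ c : ℝ) (I : Set ℝ) (z : ℝ → ℝ × ℝ) : Prop :=
  ∀ t ∈ I, HasDerivWithinAt z (vdpField lam mu nu κ c t (z t)) I t

/-! ### The first-order system: equivalence, Lipschitz bounds, uniqueness. -/

section Curve

variable {lam mu nu : ℝ → ℝ} {κ c : ℝ} {I J : Set ℝ} {z w : ℝ → ℝ × ℝ}

lemma IsVdPCurveOn.mono (h : IsVdPCurveOn lam mu nu κ c I z) (hJ : J ⊆ I) :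
    IsVdPCurveOn lam mu nu κ c J z :=
  fun t ht => (h t (hJ ht)).mono hJ

lemma IsVdPCurveOn.continuousOn (h : IsVdPCurveOn lam mu nu κ c I z) : ContinuousOn z I :=
  fun t ht => (h t ht).continuousWithinAt

lemma IsVdPCurveOn.fst (h : IsVdPCurveOn lam mu nu κ c I z) {t : ℝ} (ht : t ∈ I) :
    HasDerivWithinAt (fun t => (z t).1) ((z t).2 / lam t) I t :=
  (hasFDerivAt_fst.comp_hasDerivWithinAt t (h t ht) :)

lemma IsVdPCurveOn.snd (h : IsVdPCurveOn lam mu nu κ c I z) {t : ℝ} (ht : t ∈ I) :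
    HasDerivWithinAt (fun t => (z t).2)
      (-(mu t * (κ * (z t).1 ^ 2 + c)) * ((z t).2 / lam t) - nu t * (z t).1) I t :=
  (hasFDerivAt_snd.comp_hasDerivWithinAt t (h t ht) :)

/-- The field is odd in the state because φ enters the damping only through its square. -/
lemma IsVdPCurveOn.neg (h : IsVdPCurveOn lam mu nu κ c I z) :
    IsVdPCurveOn lam mu nu κ c I (fun t => -z t) := by
  intro t ht
  refine (h t ht).neg.congr_deriv ?_
  simp only [vdpField, Prod.neg_mk, Prod.fst_neg, Prod.snd_neg, Prod.mk.injEq]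
  constructor <;> ring

lemma isVdPCurveOn_zero : IsVdPCurveOn lam mu nu κ c I (fun _ => 0) := by
  intro t _
  refine (hasDerivWithinAt_const t I (0 : ℝ × ℝ)).congr_deriv ?_
  simp [vdpField, Prod.zero_eq_mk]

/-- A curve gives a solution of the second order equation. -/
lemma IsVdPCurveOn.isSolutionOn (hI : UniqueDiffOn ℝ I) (hlam : ∀ t ∈ I, 0 < lam t)
    (h : IsVdPCurveOn lam mu nu κ c I z) :
    IsSolutionOn (fun t _ => lam t) (fun t w => mu t * (κ * w ^ 2 + c)) (fun t _ => nu t) I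
      (fun t => (z t).1) := by
  have hd : ∀ t ∈ I, derivWithin (fun t => (z t).1) I t = (z t).2 / lam t :=
    fun t ht => (h.fst ht).derivWithin (hI t ht)
  have hy : ∀ t ∈ I, lam t * derivWithin (fun t => (z t).1) I t = (z t).2 := fun t ht => by
    rw [hd t ht, mul_div_cancel₀ _ (hlam t ht).ne']
  have hy' := fun t ht => (h.snd ht).congr hy (hy t ht)
  refine ⟨fun t ht => (h.fst ht).differentiableWithinAt,
    fun t ht => (hy' t ht).differentiableWithinAt, fun t ht => ?_⟩
  rw [(hy' t ht).derivWithin (hI t ht), hd t ht]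
  ring

/-- A solution of the second order equation gives a curve. -/
lemma IsSolutionOn.isVdPCurveOn {φ : ℝ → ℝ} (hlam : ∀ t ∈ I, 0 < lam t)
    (h : IsSolutionOn (fun t _ => lam t) (fun t w => mu t * (κ * w ^ 2 + c)) (fun t _ => nu t)
      I φ) :
    IsVdPCurveOn lam mu nu κ c I (fun t => (φ t, lam t * derivWithin φ I t)) := by
  obtain ⟨h1, h2, h3⟩ := h
  intro t ht
  refine ((h1 t ht).hasDerivWithinAt.prodMk (h2 t ht).hasDerivWithinAt).congr_deriv ?_
  have h4 := h3 t ht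
  have : lam t * derivWithin φ I t / lam t = derivWithin φ I t := by
    rw [mul_div_cancel_left₀ _ (hlam t ht).ne']
  simp only [vdpField, Prod.mk.injEq, this, true_and]
  linear_combination h4

/-- On bounded sets of states and coefficients the vector field is Lipschitz. -/
lemma dist_vdpField_le {M R t : ℝ} (hκ : 0 ≤ κ) (hp : |1 / lam t| ≤ M) (hm : |mu t| ≤ M)
    (hn : |nu t| ≤ M) {z w : ℝ × ℝ} (hz : ‖z‖ ≤ R) (hw : ‖w‖ ≤ R) :
    dist (vdpField lam mu nu κ c t z) (vdpField lam mu nu κ c t w)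
      ≤ (M + M * (M * (κ * (3 * R ^ 2) + |c|)) + M) * dist z w := by
  obtain ⟨x, y⟩ := z
  obtain ⟨u, v⟩ := w
  set d := dist (x, y) (u, v) with hd
  have hM : 0 ≤ M := (abs_nonneg _).trans hp
  have hd0 : 0 ≤ d := dist_nonneg
  have hxu : |x - u| ≤ d := by
    rw [hd, Prod.dist_eq, Real.dist_eq]; exact le_max_left _ _
  have hyv : |y - v| ≤ d := by
    rw [hd, Prod.dist_eq]; exact le_max_right _ _
  rw [Prod.norm_mk, max_le_iff, Real.norm_eq_abs, Real.norm_eq_abs] at hz hw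
  have hR : 0 ≤ R := (abs_nonneg _).trans hz.1
  -- The expression is x²y - u²v, split so that each summand carries a difference.
  have hcub : |x ^ 2 * (y - v) + (x - u) * ((x + u) * v)| ≤ 3 * R ^ 2 * d := by
    calc _ ≤ |x ^ 2 * (y - v)| + |(x - u) * ((x + u) * v)| := abs_add_le _ _
      _ = |x| ^ 2 * |y - v| + |x - u| * (|x + u| * |v|) := by simp [abs_mul]
      _ ≤ R ^ 2 * d + d * ((R + R) * R) := by
          have := (abs_add_le x u).trans (add_le_add hz.1 hw.1)
          have h1 := hz.1
          have h2 := hw.2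
          gcongr
      _ = _ := by ring
  have hlin : |κ * (x ^ 2 * (y - v) + (x - u) * ((x + u) * v)) + c * (y - v)|
      ≤ (κ * (3 * R ^ 2) + |c|) * d := by
    calc _ ≤ |κ * (x ^ 2 * (y - v) + (x - u) * ((x + u) * v))| + |c * (y - v)| := abs_add_le _ _
      _ = κ * |x ^ 2 * (y - v) + (x - u) * ((x + u) * v)| + |c| * |y - v| := by
          rw [abs_mul, abs_mul, abs_of_nonneg hκ]
      _ ≤ κ * (3 * R ^ 2 * d) + |c| * d := by gcongr
      _ = _ := by ring
  rw [Prod.dist_eq, max_le_iff, Real.dist_eq, Real.dist_eq]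
  have hK : 0 ≤ M * (M * (κ * (3 * R ^ 2) + |c|)) := by positivity
  constructor
  · calc |y / lam t - v / lam t| = |1 / lam t| * |y - v| := by rw [← abs_mul]; ring_nf
      _ ≤ M * d := by gcongr
      _ ≤ _ := by gcongr; linarith
  · calc |-(mu t * (κ * x ^ 2 + c)) * (y / lam t) - nu t * x
            - (-(mu t * (κ * u ^ 2 + c)) * (v / lam t) - nu t * u)|
        = |-(mu t * (1 / lam t *
            (κ * (x ^ 2 * (y - v) + (x - u) * ((x + u) * v)) + c * (y - v))))
            + -(nu t * (x - u))| := by ring_nf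
      _ ≤ _ := abs_add_le _ _
      _ = |mu t| * (|1 / lam t| *
            |κ * (x ^ 2 * (y - v) + (x - u) * ((x + u) * v)) + c * (y - v)|)
            + |nu t| * |x - u| := by rw [abs_neg, abs_neg, abs_mul, abs_mul, abs_mul]
      _ ≤ M * (M * ((κ * (3 * R ^ 2) + |c|) * d)) + M * d := by gcongr
      _ ≤ _ := by nlinarith [mul_nonneg hM hd0]

/-- The standing assumptions on the coefficients. -/
structure VdPCoeffs (t₀ : ℝ) (lam mu nu : ℝ → ℝ) : Prop where
  lam_cont : ContinuousOn lam (Ici t₀)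
  mu_cont : ContinuousOn mu (Ici t₀)
  nu_cont : ContinuousOn nu (Ici t₀)
  lam_pos : ∀ t ∈ Ici t₀, 0 < lam t
  mu_nonneg : ∀ t ∈ Ici t₀, 0 ≤ mu t
  nu_nonneg : ∀ t ∈ Ici t₀, 0 ≤ nu t

namespace VdPCoeffs

variable {t₀ T : ℝ}

/-- A common bound for the coefficients on a compact interval. -/
lemma exists_bound (H : VdPCoeffs t₀ lam mu nu) (T : ℝ) :
    ∃ M, 0 ≤ M ∧ ∀ t ∈ Icc t₀ T, |1 / lam t| ≤ M ∧ |mu t| ≤ M ∧ |nu t| ≤ M := by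
  have hs : Icc t₀ T ⊆ Ici t₀ := Icc_subset_Ici_self
  have hp : ContinuousOn (fun t => 1 / lam t) (Icc t₀ T) :=
    continuousOn_const.div (H.lam_cont.mono hs) fun t ht => (H.lam_pos t (hs ht)).ne'
  obtain ⟨A, hA⟩ := isCompact_Icc.exists_bound_of_continuousOn hp
  obtain ⟨B, hB⟩ := isCompact_Icc.exists_bound_of_continuousOn (H.mu_cont.mono hs)
  obtain ⟨C, hC⟩ := isCompact_Icc.exists_bound_of_continuousOn (H.nu_cont.mono hs)
  refine ⟨max 0 (max A (max B C)), le_max_left _ _, fun t ht => ⟨?_, ?_, ?_⟩⟩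
  · exact (hA t ht).trans (by simp)
  · exact (hB t ht).trans (by simp)
  · exact (hC t ht).trans (by simp)

lemma exists_lipschitzOnWith (H : VdPCoeffs t₀ lam mu nu) (hκ : 0 ≤ κ) (T R : ℝ) :
    ∃ K, ∀ t ∈ Icc t₀ T,
      LipschitzOnWith K (vdpField lam mu nu κ c t) (Metric.closedBall 0 R) := by
  obtain ⟨M, hM, hb⟩ := H.exists_bound T
  have hK : 0 ≤ M + M * (M * (κ * (3 * R ^ 2) + |c|)) + M := by positivity
  refine ⟨⟨_, hK⟩, fun t ht => LipschitzOnWith.of_dist_le_mul fun z hz w hw => ?_⟩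
  obtain ⟨hp, hm, hn⟩ := hb t ht
  exact dist_vdpField_le hκ hp hm hn (by simpa using hz) (by simpa using hw)

lemma exists_common_ball {a b : ℝ} (hz : ContinuousOn z (Icc a b))
    (hw : ContinuousOn w (Icc a b)) :
    ∃ R, ∀ t ∈ Icc a b, z t ∈ Metric.closedBall 0 R ∧ w t ∈ Metric.closedBall 0 R := by
  obtain ⟨A, hA⟩ := isCompact_Icc.exists_bound_of_continuousOn hz
  obtain ⟨B, hB⟩ := isCompact_Icc.exists_bound_of_continuousOn hw
  exact ⟨max A B, fun t ht => ⟨by simpa using Or.inl (hA t ht), by simpa using Or.inr (hB t ht)⟩⟩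

/-- Two curves with the same initial value coincide. -/
lemma eqOn_of_eq_left (H : VdPCoeffs t₀ lam mu nu) (hκ : 0 ≤ κ)
    (hz : IsVdPCurveOn lam mu nu κ c (Icc t₀ T) z) (hw : IsVdPCurveOn lam mu nu κ c (Icc t₀ T) w)
    (h : z t₀ = w t₀) : EqOn z w (Icc t₀ T) := by
  obtain ⟨R, hR⟩ := exists_common_ball hz.continuousOn hw.continuousOn
  obtain ⟨K, hK⟩ := H.exists_lipschitzOnWith (c := c) hκ T R
  refine ODE_solution_unique_of_mem_Icc_right (K := K) (v := vdpField lam mu nu κ c)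
    (s := fun _ => Metric.closedBall 0 R)
    (fun t ht => hK t (Ico_subset_Icc_self ht)) hz.continuousOn (fun t ht => ?_)
    (fun t ht => (hR t (Ico_subset_Icc_self ht)).1) hw.continuousOn (fun t ht => ?_)
    (fun t ht => (hR t (Ico_subset_Icc_self ht)).2) h
  · exact (hz t (Ico_subset_Icc_self ht)).mono_of_mem_nhdsWithin (Icc_mem_nhdsGE_of_mem ht)
  · exact (hw t (Ico_subset_Icc_self ht)).mono_of_mem_nhdsWithin (Icc_mem_nhdsGE_of_mem ht)

/-- Two curves with the same terminal value coincide. -/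
lemma eqOn_of_eq_right (H : VdPCoeffs t₀ lam mu nu) (hκ : 0 ≤ κ)
    (hz : IsVdPCurveOn lam mu nu κ c (Icc t₀ T) z) (hw : IsVdPCurveOn lam mu nu κ c (Icc t₀ T) w)
    (h : z T = w T) : EqOn z w (Icc t₀ T) := by
  obtain ⟨R, hR⟩ := exists_common_ball hz.continuousOn hw.continuousOn
  obtain ⟨K, hK⟩ := H.exists_lipschitzOnWith (c := c) hκ T R
  refine ODE_solution_unique_of_mem_Icc_left (K := K) (v := vdpField lam mu nu κ c)
    (s := fun _ => Metric.closedBall 0 R)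
    (fun t ht => hK t (Ioc_subset_Icc_self ht)) hz.continuousOn (fun t ht => ?_)
    (fun t ht => (hR t (Ioc_subset_Icc_self ht)).1) hw.continuousOn (fun t ht => ?_)
    (fun t ht => (hR t (Ioc_subset_Icc_self ht)).2) h
  · exact (hz t (Ioc_subset_Icc_self ht)).mono_of_mem_nhdsWithin (Icc_mem_nhdsLE_of_mem ht)
  · exact (hw t (Ioc_subset_Icc_self ht)).mono_of_mem_nhdsWithin (Icc_mem_nhdsLE_of_mem ht)

end VdPCoeffs

end Curve

lemma monotoneOn_of_hasDerivWithinAt {f f' : ℝ → ℝ} {D : Set ℝ} (hD : Convex ℝ D)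
    (hf : ∀ t ∈ D, HasDerivWithinAt f (f' t) D t) (hf' : ∀ t ∈ D, 0 ≤ f' t) : MonotoneOn f D :=
  monotoneOn_of_hasDerivWithinAt_nonneg hD (fun t ht => (hf t ht).continuousWithinAt)
    (fun t ht => (hf t (interior_subset ht)).mono interior_subset)
    fun t ht => hf' t (interior_subset ht)

lemma antitoneOn_of_hasDerivWithinAt {f f' : ℝ → ℝ} {D : Set ℝ} (hD : Convex ℝ D)
    (hf : ∀ t ∈ D, HasDerivWithinAt f (f' t) D t) (hf' : ∀ t ∈ D, f' t ≤ 0) : AntitoneOn f D := by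
  have := monotoneOn_of_hasDerivWithinAt hD (fun t ht => (hf t ht).neg)
    (fun t ht => neg_nonneg.2 (hf' t ht))
  intro x hx y hy hxy
  exact neg_le_neg_iff.1 (this hx hy hxy)

/-! ### Global existence by truncation. -/

/-- Truncation of a real number to `[-R, R]`. -/
noncomputable def truncate (R x : ℝ) : ℝ := max (-R) (min x R)

section Truncate

variable {R : ℝ}

lemma abs_truncate_le (hR : 0 ≤ R) (x : ℝ) : |truncate R x| ≤ R := by
  rw [truncate, abs_le]
  exact ⟨le_max_left _ _, max_le (by linarith) (min_le_right _ _)⟩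

lemma truncate_of_abs_le {x : ℝ} (hx : |x| ≤ R) : truncate R x = x := by
  rw [abs_le] at hx
  rw [truncate, min_eq_left hx.2, max_eq_right hx.1]

lemma abs_truncate_le_abs (hR : 0 ≤ R) (x : ℝ) : |truncate R x| ≤ |x| := by
  rcases le_total |x| R with h | h
  · rw [truncate_of_abs_le h]
  · exact (abs_truncate_le hR x).trans h

/-- Truncation preserves signs; this is what keeps the cubic damping dissipative in the truncated
system. -/
lemma truncate_mul_self_nonneg (hR : 0 ≤ R) (x : ℝ) : 0 ≤ truncate R x * x := by
  rcases le_total 0 x with h | h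
  · exact mul_nonneg (le_max_of_le_right (le_min h hR)) h
  · exact mul_nonneg_of_nonpos_of_nonpos (max_le (by linarith) (min_le_of_left_le h)) h

lemma abs_truncate_sub_le (x y : ℝ) : |truncate R x - truncate R y| ≤ |x - y| := by
  have h : LipschitzWith 1 (truncate R) := (LipschitzWith.id.min_const R).const_max (-R)
  simpa [Real.dist_eq] using h.dist_le_mul x y

/-- Coordinatewise truncation. -/
noncomputable def truncatePair (R : ℝ) (z : ℝ × ℝ) : ℝ × ℝ := (truncate R z.1, truncate R z.2)

lemma norm_truncatePair_le (hR : 0 ≤ R) (z : ℝ × ℝ) : ‖truncatePair R z‖ ≤ R :=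
  max_le (abs_truncate_le hR _) (abs_truncate_le hR _)

lemma dist_truncatePair_le (z w : ℝ × ℝ) : dist (truncatePair R z) (truncatePair R w) ≤ dist z w :=
  max_le_max (abs_truncate_sub_le _ _) (abs_truncate_sub_le _ _)

end Truncate

namespace VdPCoeffs

variable {lam mu nu : ℝ → ℝ} {κ c t₀ T : ℝ}

/-- The truncated system is solvable on every compact interval. -/
lemma exists_truncated (H : VdPCoeffs t₀ lam mu nu) (hκ : 0 ≤ κ) (hT : t₀ ≤ T) {R : ℝ}
    (hR : 0 ≤ R) (z₀ : ℝ × ℝ) :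
    ∃ z : ℝ → ℝ × ℝ, z t₀ = z₀ ∧ ∀ t ∈ Icc t₀ T,
      HasDerivWithinAt z (vdpField lam mu nu κ c t (truncatePair R (z t))) (Icc t₀ T) t := by
  obtain ⟨K, hK⟩ := H.exists_lipschitzOnWith (c := c) hκ T R
  have hmem : ∀ z, truncatePair R z ∈ Metric.closedBall (0 : ℝ × ℝ) R := fun z => by
    simpa using norm_truncatePair_le hR z
  have hzero : ∀ t, vdpField lam mu nu κ c t 0 = 0 := fun t => by
    simp [vdpField, Prod.zero_eq_mk]
  -- The field vanishes at 0 and sees only states of norm at most R, so its norm is at most K * R.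
  -- The ball of radius K * R * (T - t₀) therefore imposes no restriction on the time interval.
  have hpl : IsPicardLindelof (fun t z => vdpField lam mu nu κ c t (truncatePair R z))
      (⟨t₀, left_mem_Icc.2 hT⟩ : Icc t₀ T) z₀
      (K * R.toNNReal * (T - t₀).toNNReal) 0 (K * R.toNNReal) K := by
    refine ⟨fun t ht => ?_, fun z _ => ?_, fun t ht z _ => ?_, ?_⟩
    · refine LipschitzOnWith.of_dist_le_mul fun z _ w _ => ?_
      exact ((hK t ht).dist_le_mul _ (hmem z) _ (hmem w)).trans
        (mul_le_mul_of_nonneg_left (dist_truncatePair_le z w) K.2)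
    · have hs : Icc t₀ T ⊆ Ici t₀ := Icc_subset_Ici_self
      have hl : ∀ t ∈ Icc t₀ T, lam t ≠ 0 := fun t ht => (H.lam_pos t (hs ht)).ne'
      have h1 := H.lam_cont.mono hs
      have h2 := H.mu_cont.mono hs
      have h3 := H.nu_cont.mono hs
      have h4 : ContinuousOn (fun t => (truncatePair R z).2 / lam t) (Icc t₀ T) :=
        continuousOn_const.div h1 hl
      exact h4.prodMk (((h2.mul continuousOn_const).neg.mul h4).sub (h3.mul continuousOn_const))
    · have h := (hK t ht).dist_le_mul _ (hmem z) 0 (by simpa using hR)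
      rw [hzero, dist_zero_right, dist_zero_right] at h
      refine h.trans ?_
      rw [NNReal.coe_mul, Real.coe_toNNReal R hR]
      exact mul_le_mul_of_nonneg_left (norm_truncatePair_le hR z) K.2
    · simp [hT]
  obtain ⟨z, hz0, hz⟩ := hpl.exists_eq_forall_mem_Icc_hasDerivWithinAt₀
  exact ⟨z, hz0, hz⟩

/-- A growth bound for the truncated system, uniform in the truncation. -/
lemma exists_growth_bound (H : VdPCoeffs t₀ lam mu nu) (hκ : 0 ≤ κ) (c T : ℝ) :
    ∃ C : ℝ, 0 ≤ C ∧ ∀ (R : ℝ) (z : ℝ → ℝ × ℝ), 0 ≤ R → (∀ t ∈ Icc t₀ T,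
      HasDerivWithinAt z (vdpField lam mu nu κ c t (truncatePair R (z t))) (Icc t₀ T) t) →
      ∀ t ∈ Icc t₀ T, (z t).1 ^ 2 + (z t).2 ^ 2
        ≤ ((z t₀).1 ^ 2 + (z t₀).2 ^ 2) * Real.exp (C * (T - t₀)) := by
  obtain ⟨M, hM, hb⟩ := H.exists_bound T
  -- The summands bound, in order, the contributions of φ' = y / λ, of ν, and of the constant part c
  -- of the damping. Nothing depends on R or κ.
  set C := M + M + 2 * (M * M * |c|) with hC
  have hC0 : 0 ≤ C := by positivity
  refine ⟨C, hC0, fun R z hR hz t ht => ?_⟩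
  have hx := fun s hs => (hasFDerivAt_fst.comp_hasDerivWithinAt s (hz s hs) :)
  have hy := fun s hs => (hasFDerivAt_snd.comp_hasDerivWithinAt s (hz s hs) :)
  have hE := fun s hs => (((hx s hs).pow 2).add ((hy s hs).pow 2)).mul
    ((((hasDerivWithinAt_id s (Icc t₀ T)).sub_const t₀).const_mul (-C)).exp)
  have hanti := antitoneOn_of_hasDerivWithinAt (convex_Icc t₀ T) hE ?_
  · have h := hanti (left_mem_Icc.2 (ht.1.trans ht.2)) ht ht.1
    simp only [Pi.mul_apply, Pi.add_apply, Pi.pow_apply, Function.comp_apply, id_eq, sub_self,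
      mul_zero, Real.exp_zero, mul_one] at h
    have h0 : 0 ≤ (z t₀).1 ^ 2 + (z t₀).2 ^ 2 := by positivity
    calc (z t).1 ^ 2 + (z t).2 ^ 2
        = ((z t).1 ^ 2 + (z t).2 ^ 2) * Real.exp (-C * (t - t₀)) * Real.exp (C * (t - t₀)) := by
          rw [mul_assoc, ← Real.exp_add]; simp
      _ ≤ ((z t₀).1 ^ 2 + (z t₀).2 ^ 2) * Real.exp (C * (t - t₀)) := by gcongr
      _ ≤ _ := by
          have := ht.2
          gcongr
  · intro s hs
    obtain ⟨hp, hm, hn⟩ := hb s hs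
    have hs' : s ∈ Ici t₀ := hs.1
    have hp0 : 0 ≤ 1 / lam s := (one_div_pos.2 (H.lam_pos s hs')).le
    have hm0 := H.mu_nonneg s hs'
    have hn0 := H.nu_nonneg s hs'
    rw [abs_of_nonneg hp0] at hp
    rw [abs_of_nonneg hm0] at hm
    rw [abs_of_nonneg hn0] at hn
    have hexp := Real.exp_pos (-C * (id s - t₀))
    set x := (z s).1 with hxd
    set y := (z s).2 with hyd
    set X := truncate R x with hX
    set Y := truncate R y with hY
    set p := 1 / lam s with hpd
    have hxX : |X| ≤ |x| := abs_truncate_le_abs hR x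
    have hyY : |Y| ≤ |y| := abs_truncate_le_abs hR y
    have hYy : 0 ≤ Y * y := truncate_mul_self_nonneg hR y
    have hYy' : Y * y ≤ y ^ 2 := by
      calc Y * y ≤ |Y * y| := le_abs_self _
        _ = |Y| * |y| := abs_mul _ _
        _ ≤ |y| * |y| := by gcongr
        _ = y ^ 2 := by rw [← sq, sq_abs]
    have hxy : 2 * (|x| * |y|) ≤ x ^ 2 + y ^ 2 := by
      rw [← sq_abs x, ← sq_abs y]; nlinarith [sq_nonneg (|x| - |y|)]
    have h1 : 2 * (p * (x * Y)) ≤ M * (x ^ 2 + y ^ 2) := by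
      calc 2 * (p * (x * Y)) ≤ 2 * (p * (|x| * |y|)) := by
            have : x * Y ≤ |x| * |y| :=
              calc x * Y ≤ |x * Y| := le_abs_self _
                _ = |x| * |Y| := abs_mul _ _
                _ ≤ _ := by gcongr
            gcongr
        _ = p * (2 * (|x| * |y|)) := by ring
        _ ≤ _ := by gcongr
    have h2 : -(2 * (nu s * (X * y))) ≤ M * (x ^ 2 + y ^ 2) := by
      calc -(2 * (nu s * (X * y))) = nu s * (2 * (-(X * y))) := by ring
        _ ≤ nu s * (2 * (|x| * |y|)) := by
            gcongr
            calc -(X * y) ≤ |X * y| := neg_le_abs _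
              _ = |X| * |y| := abs_mul _ _
              _ ≤ _ := by gcongr
        _ ≤ _ := by gcongr
    have h3 : -(2 * (mu s * p * ((κ * X ^ 2 + c) * (Y * y))))
        ≤ 2 * (M * M * |c|) * (x ^ 2 + y ^ 2) := by
      -- The κ part has the favourable sign and is discarded.
      have h4 : -((κ * X ^ 2 + c) * (Y * y)) ≤ |c| * (x ^ 2 + y ^ 2) := by
        calc -((κ * X ^ 2 + c) * (Y * y)) = -c * (Y * y) - κ * X ^ 2 * (Y * y) := by ring
          _ ≤ -c * (Y * y) := sub_le_self _ (by positivity)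
          _ ≤ |c| * (Y * y) := by gcongr; exact neg_le_abs c
          _ ≤ |c| * (x ^ 2 + y ^ 2) := by gcongr; nlinarith [sq_nonneg x]
      calc -(2 * (mu s * p * ((κ * X ^ 2 + c) * (Y * y))))
          = 2 * (mu s * p * -((κ * X ^ 2 + c) * (Y * y))) := by ring
        _ ≤ 2 * (mu s * p * (|c| * (x ^ 2 + y ^ 2))) := by gcongr
        _ ≤ 2 * (M * M * (|c| * (x ^ 2 + y ^ 2))) := by gcongr
        _ = _ := by ring
    have hY1 : Y / lam s = p * Y := by rw [hpd]; ring
    simp only [vdpField, truncatePair, ContinuousLinearMap.coe_fst', ContinuousLinearMap.coe_snd',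
      Pi.add_apply, Pi.pow_apply, Function.comp_apply, ← hxd, ← hyd, ← hX, ← hY, hY1]
    rw [show ∀ A B D E : ℝ, A * E + B * (E * D) = (A + B * D) * E by intros; ring]
    refine mul_nonpos_of_nonpos_of_nonneg ?_ hexp.le
    rw [hC]
    norm_num
    linear_combination h1 + h2 + h3

/-- Solvability on compact intervals. -/
lemma exists_curve_Icc (H : VdPCoeffs t₀ lam mu nu) (hκ : 0 ≤ κ) (c : ℝ) (hT : t₀ ≤ T)
    (z₀ : ℝ × ℝ) : ∃ z, z t₀ = z₀ ∧ IsVdPCurveOn lam mu nu κ c (Icc t₀ T) z := by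
  obtain ⟨C, hC, hgrowth⟩ := H.exists_growth_bound hκ c T
  -- R is the growth bound itself, so the truncation never acts on the solution.
  set R := Real.sqrt ((z₀.1 ^ 2 + z₀.2 ^ 2) * Real.exp (C * (T - t₀))) with hRd
  have hR : 0 ≤ R := Real.sqrt_nonneg _
  obtain ⟨z, hz0, hz⟩ := H.exists_truncated (c := c) hκ hT hR z₀
  refine ⟨z, hz0, fun t ht => ?_⟩
  have hg := hgrowth R z hR hz t ht
  rw [hz0] at hg
  have h1 : |(z t).1| ≤ R := Real.abs_le_sqrt ((le_add_of_nonneg_right (sq_nonneg _)).trans hg)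
  have h2 : |(z t).2| ≤ R := Real.abs_le_sqrt ((le_add_of_nonneg_left (sq_nonneg _)).trans hg)
  have h3 : truncatePair R (z t) = z t :=
    Prod.ext (truncate_of_abs_le h1) (truncate_of_abs_le h2)
  simpa only [h3] using hz t ht

/-- Solvability on the half-line. -/
lemma exists_curve_Ici (H : VdPCoeffs t₀ lam mu nu) (hκ : 0 ≤ κ) (c : ℝ) (z₀ : ℝ × ℝ) :
    ∃ z, z t₀ = z₀ ∧ IsVdPCurveOn lam mu nu κ c (Ici t₀) z := by
  -- The extra 1 puts t strictly below the right end of the interval with index ⌈t - t₀⌉₊, so that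
  -- the glued curve agrees with one piece near t.
  have hle : ∀ n : ℕ, t₀ ≤ t₀ + n + 1 := fun n => by
    have : (0 : ℝ) ≤ n := n.cast_nonneg
    linarith
  choose z hz0 hz using fun n : ℕ => H.exists_curve_Icc hκ c (hle n) z₀
  have hcoh : ∀ n : ℕ, EqOn (fun t => z ⌈t - t₀⌉₊ t) (z n) (Icc t₀ (t₀ + n + 1)) := by
    intro n t ht
    have hm : t ∈ Icc t₀ (t₀ + ⌈t - t₀⌉₊ + 1) := ⟨ht.1, by linarith [Nat.le_ceil (t - t₀)]⟩
    have hmin : t ∈ Icc t₀ (min (t₀ + ⌈t - t₀⌉₊ + 1) (t₀ + n + 1)) := ⟨ht.1, le_min hm.2 ht.2⟩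
    exact H.eqOn_of_eq_left hκ ((hz _).mono (Icc_subset_Icc_right (min_le_left _ _)))
      ((hz n).mono (Icc_subset_Icc_right (min_le_right _ _))) (by rw [hz0, hz0]) hmin
  refine ⟨fun t => z ⌈t - t₀⌉₊ t, by simp [hz0], fun t ht => ?_⟩
  have htn : t < t₀ + ⌈t - t₀⌉₊ + 1 := by linarith [Nat.le_ceil (t - t₀)]
  have hmem : t ∈ Icc t₀ (t₀ + ⌈t - t₀⌉₊ + 1) := ⟨ht, htn.le⟩
  refine ((hz _ t hmem).congr (hcoh _) (hcoh _ hmem)).mono_of_mem_nhdsWithin ?_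
  rw [← Ici_inter_Iic]
  exact inter_mem self_mem_nhdsWithin (mem_nhdsWithin_of_mem_nhds (Iic_mem_nhds htn))

end VdPCoeffs

/-! ### Oscillation. -/

lemma hasDerivWithinAt_integral_Ici {h : ℝ → ℝ} {t₀ : ℝ} (hc : ContinuousOn h (Ici t₀)) {t : ℝ}
    (ht : t ∈ Ici t₀) : HasDerivWithinAt (fun u => ∫ s in t₀..u, h s) (h t) (Ici t₀) t := by
  -- Freezing h to the left of t₀ gives a function continuous on all of ℝ.
  have hg : Continuous fun s => h (max t₀ s) :=
    hc.comp_continuous (by fun_prop) fun s => mem_Ici.2 (le_max_left _ _)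
  have heq : ∀ u ∈ Ici t₀, ∫ s in t₀..u, h s = ∫ s in t₀..u, h (max t₀ s) := fun u hu =>
    intervalIntegral.integral_congr fun s hs => by
      rw [uIcc_of_le hu] at hs
      simp [max_eq_right hs.1]
  have hd : HasDerivWithinAt (fun u => ∫ s in t₀..u, h (max t₀ s)) (h (max t₀ t)) (Ici t₀) t :=
    (hg.integral_hasStrictDerivAt t₀ t).hasDerivAt.hasDerivWithinAt
  rw [max_eq_right ht] at hd
  exact hd.congr heq (heq t ht)

/-- A positive function whose sum with a multiple of a divergent function is nonincreasing cannot
exist. -/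
lemma false_of_antitoneOn_add {f g : ℝ → ℝ} {c T : ℝ} (hc : 0 < c) (hf : ∀ t ∈ Ici T, 0 < f t)
    (hg : Tendsto g atTop atTop) (h : AntitoneOn (fun t => f t + c * g t) (Ici T)) : False := by
  obtain ⟨t, ht1, ht2⟩ :=
    ((hg.eventually_ge_atTop ((f T + c * g T) / c)).and (eventually_ge_atTop T)).exists
  have h1 : f t + c * g t ≤ f T + c * g T := h self_mem_Ici ht2 ht2
  have h2 := hf t ht2
  rw [div_le_iff₀ hc] at ht1
  linarith

namespace VdPCoeffs

variable {lam mu nu : ℝ → ℝ} {t₀ : ℝ} {z : ℝ → ℝ × ℝ}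

lemma continuousOn_damping (H : VdPCoeffs t₀ lam mu nu) {k : ℝ → ℝ}
    (hk : ContinuousOn k (Ici t₀)) : ContinuousOn (fun t => mu t * k t / lam t) (Ici t₀) :=
  (H.mu_cont.mul hk).div H.lam_cont fun t ht => (H.lam_pos t ht).ne'

/-- Sturm type comparison: a solution of the nonlinear equation that is at least `ε` and
nondecreasing near infinity excludes oscillation of the linear equation. -/
lemma not_isOscillatory_of_nonneg (H : VdPCoeffs t₀ lam mu nu) {ε T : ℝ} (hε : 0 < ε)
    (hT : t₀ ≤ T) (hz : IsVdPCurveOn lam mu nu 1 (-1) (Ici t₀) z)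
    (hφ : ∀ t ∈ Ici T, ε ≤ (z t).1) (hy : ∀ t ∈ Ici T, 0 ≤ (z t).2) {u : ℝ → ℝ × ℝ}
    (hu : IsVdPCurveOn lam mu nu 0 (ε ^ 2 - 1) (Ici t₀) u) :
    ¬ IsOscillatory (fun t => (u t).1) := by
  intro hosc
  -- The signs -, +, - produce zeros a and b of the linear solution around t₂, where it is positive.
  obtain ⟨t₁, ht₁, hu₁⟩ := (hosc T).1
  obtain ⟨t₂, ht₂, hu₂⟩ := (hosc t₁).2
  obtain ⟨t₃, ht₃, hu₃⟩ := (hosc t₂).1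
  rw [mem_Ici] at ht₁ ht₂ ht₃
  have hcont : ContinuousOn (fun t => (u t).1) (Ici t₀) :=
    fun t ht => (hu.fst ht).continuousWithinAt
  obtain ⟨a, ha, hua⟩ := intermediate_value_Icc ht₂
    (hcont.mono fun t ht => hT.trans (ht₁.trans ht.1)) ⟨hu₁.le, hu₂.le⟩
  obtain ⟨b, hb, hub⟩ := intermediate_value_Icc' ht₃
    (hcont.mono fun t ht => hT.trans (ht₁.trans (ht₂.trans ht.1))) ⟨hu₃.le, hu₂.le⟩
  simp only at hua hub hu₂
  have hsub : Icc a b ⊆ Ici T := fun t ht => ht₁.trans (ha.1.trans ht.1)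
  have hsub' : Icc a b ⊆ Ici t₀ := fun t ht => hT.trans (hsub ht)
  set q : ℝ → ℝ := fun t => mu t * (ε ^ 2 - 1) / lam t with hq
  set Q : ℝ → ℝ := fun t => ∫ s in t₀..t, q s with hQd
  have hQ : ∀ t ∈ Icc a b, HasDerivWithinAt Q (q t) (Icc a b) t := fun t ht =>
    (hasDerivWithinAt_integral_Ici (H.continuousOn_damping continuousOn_const)
      (hsub' ht)).mono hsub'
  have hz' := hz.mono hsub'
  have hu' := hu.mono hsub'
  have hne : ∀ t ∈ Icc a b, (z t).1 ≠ 0 := fun t ht => (hε.trans_le (hφ t (hsub ht))).ne'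
  -- Picone's expression. The derivative of exp(Q) G is a square plus a multiple of μ(φ² - ε²)y,
  -- both nonnegative, and G(a) = 0. Since (u/φ)² has derivative 2G/(λφ²), it cannot return to 0 at
  -- b after being positive at t₂.
  set G : ℝ → ℝ := fun t => (u t).1 * (u t).2 - (z t).2 * (u t).1 ^ 2 / (z t).1 with hG
  have hF : MonotoneOn (fun t => Real.exp (Q t) * G t) (Icc a b) := by
    refine monotoneOn_of_hasDerivWithinAt (convex_Icc a b) (fun t ht =>
      (hQ t ht).exp.mul (((hu'.fst ht).mul (hu'.snd ht)).sub
        (((hz'.snd ht).mul ((hu'.fst ht).pow 2)).div (hz'.fst ht) (hne t ht)))) fun t ht => ?_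
    have hl := H.lam_pos t (hsub' ht)
    have hm := H.mu_nonneg t (hsub' ht)
    have hφt := hφ t (hsub ht)
    have hyt := hy t (hsub ht)
    have hpos := hε.trans_le hφt
    have hsq : 0 ≤ (z t).1 ^ 2 - ε ^ 2 := sub_nonneg.2 (by gcongr)
    have key : 0 ≤ Real.exp (Q t) * ((((u t).2 * (z t).1 - (z t).2 * (u t).1) / (z t).1) ^ 2 / lam t
        + mu t * ((z t).1 ^ 2 - ε ^ 2) / lam t * ((z t).2 * (u t).1 ^ 2 / (z t).1)) := by
      positivity
    refine key.trans_eq ?_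
    simp only [Pi.mul_apply, Pi.pow_apply, hG, hq]
    field_simp
    ring
  have ha_mem : a ∈ Icc a b := ⟨le_rfl, ha.2.trans hb.1⟩
  have hGnonneg : ∀ t ∈ Icc a b, 0 ≤ G t := fun t ht => by
    have h := hF ha_mem ht ht.1
    have hGa : G a = 0 := by simp [hG, hua]
    simp only [hGa, mul_zero] at h
    exact nonneg_of_mul_nonneg_right h (Real.exp_pos _)
  have hmono : MonotoneOn (fun t => ((u t).1 / (z t).1) ^ 2) (Icc a b) := by
    refine monotoneOn_of_hasDerivWithinAt (convex_Icc a b) (fun t ht =>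
      ((hu'.fst ht).div (hz'.fst ht) (hne t ht)).pow 2) fun t ht => ?_
    have hl := H.lam_pos t (hsub' ht)
    have hpos := hε.trans_le (hφ t (hsub ht))
    have key : 0 ≤ 2 * (G t / (lam t * (z t).1 ^ 2)) :=
      mul_nonneg zero_le_two (div_nonneg (hGnonneg t ht) (by positivity))
    refine key.trans_eq ?_
    simp only [hG, Pi.div_apply, Nat.cast_ofNat, Nat.add_one_sub_one, pow_one]
    field_simp
  have h := hmono ⟨ha.2, hb.1⟩ ⟨ha.2.trans hb.1, le_rfl⟩ hb.1
  have hpos : 0 < (u t₂).1 / (z t₂).1 :=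
    div_pos hu₂ (hε.trans_le (hφ t₂ (ht₁.trans ht₂)))
  simp only [hub, zero_div] at h
  nlinarith [sq_pos_of_pos hpos]

/-- Along a positive solution, `λ φ'` stays negative once it is negative. -/
lemma snd_neg_of_pos (H : VdPCoeffs t₀ lam mu nu) {T : ℝ} (hT : t₀ ≤ T)
    (hz : IsVdPCurveOn lam mu nu 1 (-1) (Ici t₀) z) (hφ : ∀ t ∈ Ici T, 0 < (z t).1)
    (hyT : (z T).2 < 0) : ∀ t ∈ Ici T, (z t).2 < 0 := by
  have hsub : Ici T ⊆ Ici t₀ := Ici_subset_Ici.2 hT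
  have hφc : ContinuousOn (fun t => (z t).1 ^ 2 - 1) (Ici t₀) :=
    fun t ht => ((hz.fst ht).continuousWithinAt.pow 2).sub continuousWithinAt_const
  have hQ := fun t (ht : t ∈ Ici T) => (hasDerivWithinAt_integral_Ici (H.continuousOn_damping hφc)
    (hsub ht)).mono hsub
  have hanti := antitoneOn_of_hasDerivWithinAt (convex_Ici T)
    (fun t ht => (hQ t ht).exp.mul ((hz.mono hsub).snd ht)) fun t ht => by
      have hn := mul_nonneg (Real.exp_pos (∫ s in t₀..t, mu s * ((z s).1 ^ 2 - 1) / lam s)).le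
        (mul_nonneg (H.nu_nonneg t (hsub ht)) (hφ t ht).le)
      refine le_of_eq_of_le ?_ (neg_nonpos.2 hn)
      ring
  intro t ht
  have h := hanti self_mem_Ici ht ht
  simp only [Pi.mul_apply] at h
  have h1 := h.trans_lt (mul_neg_of_pos_of_neg (Real.exp_pos _) hyT)
  exact neg_of_mul_neg_right h1 (Real.exp_pos _).le

/-- The inner integral of the divergence condition, with the integrating factor pulled out. -/
lemma integral_exp_mul_eq (H : VdPCoeffs t₀ lam mu nu) {k : ℝ → ℝ}
    (hk : ContinuousOn k (Ici t₀)) {τ : ℝ} (hτ : t₀ ≤ τ) :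
    ∫ s in t₀..τ, Real.exp (-∫ ξ in s..τ, mu ξ * k ξ / lam ξ) * nu s
      = Real.exp (-∫ ξ in t₀..τ, mu ξ * k ξ / lam ξ) *
        ∫ s in t₀..τ, Real.exp (∫ ξ in t₀..s, mu ξ * k ξ / lam ξ) * nu s := by
  have hq := H.continuousOn_damping hk
  have hint : ∀ s ∈ Ici t₀,
      IntervalIntegrable (fun ξ => mu ξ * k ξ / lam ξ) MeasureTheory.volume t₀ s := fun s hs =>
    (hq.mono (by rw [uIcc_of_le hs]; exact Icc_subset_Ici_self)).intervalIntegrable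
  rw [← intervalIntegral.integral_const_mul]
  refine intervalIntegral.integral_congr fun s hs => ?_
  rw [uIcc_of_le hτ] at hs
  rw [← intervalIntegral.integral_interval_sub_left (hint τ hτ) (hint s hs.1), ← mul_assoc,
    ← Real.exp_add]
  ring_nf

/-- Under the divergence condition no positive solution has `λ φ' < 0` near infinity. -/
lemma false_of_pos_of_snd_neg (H : VdPCoeffs t₀ lam mu nu)
    (hdiv : DivergenceCondition t₀ lam mu nu) {T : ℝ} (hT : t₀ ≤ T)
    (hz : IsVdPCurveOn lam mu nu 1 (-1) (Ici t₀) z) (hφ : ∀ t ∈ Ici T, 0 < (z t).1)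
    (hy : ∀ t ∈ Ici T, (z t).2 < 0) : False := by
  have hp : ContinuousOn (fun t => 1 / lam t) (Ici t₀) :=
    continuousOn_const.div H.lam_cont fun t ht => (H.lam_pos t ht).ne'
  have hsub : Ici T ⊆ Ici t₀ := Ici_subset_Ici.2 hT
  have hφanti : AntitoneOn (fun t => (z t).1) (Ici T) :=
    antitoneOn_of_hasDerivWithinAt (convex_Ici T) (fun t ht => (hz.mono hsub).fst ht) fun t ht =>
      div_nonpos_of_nonpos_of_nonneg (hy t ht).le (H.lam_pos t (hsub ht)).le
  -- Once φ ≤ 1 the damping coefficient is nonpositive, so y decreases and φ' ≤ y(S)/λ: the first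
  -- divergence suffices. If φ > 1 throughout, ε = φ(T) bounds φ from above and the second one
  -- applies.
  by_cases hone : ∃ S ∈ Ici T, (z S).1 ≤ 1
  · obtain ⟨S, hS, hS1⟩ := hone
    have hST : Ici S ⊆ Ici T := Ici_subset_Ici.2 hS
    have hS0 : Ici S ⊆ Ici t₀ := hST.trans hsub
    have hyanti : AntitoneOn (fun t => (z t).2) (Ici S) :=
      antitoneOn_of_hasDerivWithinAt (convex_Ici S) (fun t ht => (hz.mono hS0).snd ht)
        fun t ht => by
          have h1 : (z t).1 ≤ 1 := (hφanti hS (hST ht) ht).trans hS1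
          have h0 := hφ t (hST ht)
          have h2 : 0 ≤ mu t * (1 - (z t).1 ^ 2) * (-(z t).2 / lam t) :=
            mul_nonneg (mul_nonneg (H.mu_nonneg t (hS0 ht)) (by nlinarith))
              (div_nonneg (neg_nonneg.2 (hy t (hST ht)).le) (H.lam_pos t (hS0 ht)).le)
          have h3 := mul_nonneg (H.nu_nonneg t (hS0 ht)) h0.le
          have h4 : -(z t).2 / lam t = -((z t).2 / lam t) := neg_div _ _
          rw [h4] at h2
          linear_combination h2 + h3
    refine false_of_antitoneOn_add (neg_pos.2 (hy S hS)) (fun t ht => hφ t (hST ht)) hdiv.1 ?_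
    refine antitoneOn_of_hasDerivWithinAt (convex_Ici S) (fun t ht => ((hz.mono hS0).fst ht).add
      (((hasDerivWithinAt_integral_Ici hp (hS0 ht)).mono hS0).const_mul _)) fun t ht => ?_
    have h1 : (z t).2 ≤ (z S).2 := hyanti self_mem_Ici ht ht
    have h2 := div_nonneg (sub_nonneg.2 h1) (H.lam_pos t (hS0 ht)).le
    refine le_of_eq_of_le ?_ (neg_nonpos.2 h2)
    ring
  · push Not at hone
    set ε := (z T).1 with hε
    have hε1 : 1 ≤ ε := (hone T self_mem_Ici).le
    set q : ℝ → ℝ := fun t => mu t * (ε ^ 2 - 1) / lam t with hqd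
    have hqc : ContinuousOn q (Ici t₀) := H.continuousOn_damping continuousOn_const
    set Q : ℝ → ℝ := fun t => ∫ s in t₀..t, q s with hQd
    have hQ : ∀ t ∈ Ici t₀, HasDerivWithinAt Q (q t) (Ici t₀) t :=
      fun t ht => hasDerivWithinAt_integral_Ici hqc ht
    have hnuc : ContinuousOn (fun t => Real.exp (Q t) * nu t) (Ici t₀) :=
      ContinuousOn.mul (fun t ht => (hQ t ht).exp.continuousWithinAt) H.nu_cont
    set N : ℝ → ℝ := fun t => ∫ s in t₀..t, Real.exp (Q s) * nu s with hNd
    have hN : ∀ t ∈ Ici t₀, HasDerivWithinAt N (Real.exp (Q t) * nu t) (Ici t₀) t :=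
      fun t ht => hasDerivWithinAt_integral_Ici hnuc ht
    have hN0 : 0 ≤ N T := intervalIntegral.integral_nonneg hT fun s hs =>
      mul_nonneg (Real.exp_pos _).le (H.nu_nonneg s hs.1)
    set Y := Real.exp (Q T) * (z T).2 with hY
    have hYneg : Y < 0 := mul_neg_of_pos_of_neg (Real.exp_pos _) (hy T self_mem_Ici)
    -- c ≤ 1 gives c ≤ φ; taking c also small absorbs the part of the integral N from t₀ to T, so
    -- that exp(Q) y ≤ -c N from T on.
    obtain ⟨c, hc0, hc1, hcN⟩ : ∃ c : ℝ, 0 < c ∧ c ≤ 1 ∧ Y + c * N T ≤ 0 := by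
      have hd : 0 < -Y / (N T + 1) := by
        apply div_pos <;> linarith
      refine ⟨min 1 (-Y / (N T + 1)), lt_min one_pos hd, min_le_left _ _, ?_⟩
      have h1 : min 1 (-Y / (N T + 1)) * N T ≤ -Y / (N T + 1) * (N T + 1) :=
        mul_le_mul (min_le_right _ _) (by linarith) hN0 hd.le
      rw [div_mul_cancel₀ _ (by linarith)] at h1
      linarith
    have hanti : AntitoneOn (fun t => Real.exp (Q t) * (z t).2 + c * N t) (Ici T) := by
      refine antitoneOn_of_hasDerivWithinAt (convex_Ici T) (fun t ht =>
        (((hQ t (hsub ht)).mono hsub).exp.mul ((hz.mono hsub).snd ht)).add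
          (((hN t (hsub ht)).mono hsub).const_mul c)) fun t ht => ?_
      have hl := H.lam_pos t (hsub ht)
      have hle : (z t).1 ≤ ε := hφanti self_mem_Ici ht ht
      have h1 : 0 ≤ mu t * (ε ^ 2 - (z t).1 ^ 2) * (-(z t).2 / lam t) :=
        mul_nonneg (mul_nonneg (H.mu_nonneg t (hsub ht))
          (sub_nonneg.2 (pow_le_pow_left₀ (hφ t ht).le hle 2)))
          (div_nonneg (neg_nonneg.2 (hy t ht).le) hl.le)
      have h2 : 0 ≤ nu t * ((z t).1 - c) :=
        mul_nonneg (H.nu_nonneg t (hsub ht)) (by linarith [hone t ht])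
      have h3 := mul_nonneg (Real.exp_pos (Q t)).le (add_nonneg h1 h2)
      refine le_of_eq_of_le ?_ (neg_nonpos.2 h3)
      simp only [hqd]
      ring
    set g : ℝ → ℝ := fun τ => 1 / lam τ *
      ∫ s in t₀..τ, Real.exp (-∫ ξ in s..τ, mu ξ * (ε ^ 2 - 1) / lam ξ) * nu s with hgd
    have hg : ∀ t ∈ Ici t₀, g t = 1 / lam t * (Real.exp (-Q t) * N t) := fun t ht => by
      rw [hgd]
      simp only [H.integral_exp_mul_eq (k := fun _ => ε ^ 2 - 1) continuousOn_const ht, hQd, hNd,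
        hqd]
    have hgc : ContinuousOn g (Ici t₀) := by
      refine ContinuousOn.congr ?_ hg
      exact hp.mul (ContinuousOn.mul (fun t ht => (hQ t ht).neg.exp.continuousWithinAt)
        fun t ht => (hN t ht).continuousWithinAt)
    refine false_of_antitoneOn_add hc0 hφ (hdiv.2 ε hε1) ?_
    refine antitoneOn_of_hasDerivWithinAt (convex_Ici T) (fun t ht => ((hz.mono hsub).fst ht).add
      (((hasDerivWithinAt_integral_Ici hgc (hsub ht)).mono hsub).const_mul c)) fun t ht => ?_
    have h1 : Real.exp (Q t) * (z t).2 + c * N t ≤ 0 := (hanti self_mem_Ici ht ht).trans hcN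
    rw [hg t (hsub ht)]
    have h2 : 0 ≤ 1 / lam t * (Real.exp (-Q t) * -(Real.exp (Q t) * (z t).2 + c * N t)) :=
      mul_nonneg (one_div_pos.2 (H.lam_pos t (hsub ht))).le
        (mul_nonneg (Real.exp_pos _).le (neg_nonneg.2 h1))
    have h3 : Real.exp (-Q t) * Real.exp (Q t) = 1 := by rw [← Real.exp_add]; simp
    refine le_of_eq_of_le ?_ (neg_nonpos.2 h2)
    linear_combination -((z t).2 / lam t) * h3

/-- Under both conditions there is no solution that is positive near infinity. -/
lemma false_of_pos (H : VdPCoeffs t₀ lam mu nu) (hdiv : DivergenceCondition t₀ lam mu nu)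
    (hosc : OscillationCondition t₀ lam mu nu) {T : ℝ} (hT : t₀ ≤ T)
    (hz : IsVdPCurveOn lam mu nu 1 (-1) (Ici t₀) z) (hφ : ∀ t ∈ Ici T, 0 < (z t).1) : False := by
  by_cases hneg : ∃ S ∈ Ici T, (z S).2 < 0
  · obtain ⟨S, hS, hyS⟩ := hneg
    have hφS : ∀ t ∈ Ici S, 0 < (z t).1 := fun t ht => hφ t (mem_Ici.2 (le_trans hS ht))
    exact H.false_of_pos_of_snd_neg hdiv (hT.trans hS) hz hφS
      (H.snd_neg_of_pos (hT.trans hS) hz hφS hyS)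
  · push Not at hneg
    have hsub : Ici T ⊆ Ici t₀ := Ici_subset_Ici.2 hT
    obtain ⟨ε₀, hε₀, hlin⟩ := hosc
    have hmono : MonotoneOn (fun t => (z t).1) (Ici T) :=
      monotoneOn_of_hasDerivWithinAt (convex_Ici T) (fun t ht => (hz.mono hsub).fst ht)
        fun t ht => div_nonneg (hneg t ht) (H.lam_pos t (hsub ht)).le
    -- Small enough for the oscillation condition, and a lower bound of φ since φ is nondecreasing.
    set ε := min ε₀ (z T).1
    have hε : 0 < ε := lt_min hε₀ (hφ T self_mem_Ici)
    obtain ⟨u, hu0, hu⟩ := H.exists_curve_Ici le_rfl (ε ^ 2 - 1) (1, 0)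
    refine H.not_isOscillatory_of_nonneg hε hT hz
      (fun t ht => (min_le_right _ _).trans (hmono self_mem_Ici ht ht)) hneg hu ?_
    refine hlin ε hε (min_le_left _ _) _ ?_ ⟨t₀, self_mem_Ici, by simp [hu0]⟩
    simpa using hu.isSolutionOn (uniqueDiffOn_Ici t₀) H.lam_pos

/-- A solution that is nonnegative near infinity and nontrivial is positive near infinity. -/
lemma pos_of_nonneg (H : VdPCoeffs t₀ lam mu nu) {κ c T : ℝ} (hκ : 0 ≤ κ) (hT : t₀ ≤ T)
    (hz : IsVdPCurveOn lam mu nu κ c (Ici t₀) z) (h0 : z t₀ ≠ 0)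
    (hφ : ∀ t ∈ Ici T, 0 ≤ (z t).1) : ∀ t ∈ Ioi T, 0 < (z t).1 := by
  intro t ht
  refine (hφ t (mem_Ici.2 (le_of_lt ht))).lt_of_ne' fun h => h0 ?_
  have htt : t₀ < t := hT.trans_lt ht
  have hd := (hz.fst htt.le).hasDerivAt (Ici_mem_nhds htt)
  -- A zero would be an interior minimum, so y vanishes there too, and backward uniqueness carries
  -- the zero state to t₀.
  have hmin : IsLocalMin (fun s => (z s).1) t := by
    filter_upwards [Ici_mem_nhds ht] with s hs
    simpa only [h] using hφ s hs
  have hy : (z t).2 = 0 := by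
    have := hmin.hasDerivAt_eq_zero hd
    exact (div_eq_zero_iff.1 this).resolve_right (H.lam_pos t htt.le).ne'
  exact H.eqOn_of_eq_right hκ (hz.mono Icc_subset_Ici_self) isVdPCurveOn_zero
    (Prod.ext h hy) (left_mem_Icc.2 htt.le)

/-- Some value in every half-line is negative. -/
lemma exists_neg (H : VdPCoeffs t₀ lam mu nu) (hdiv : DivergenceCondition t₀ lam mu nu)
    (hosc : OscillationCondition t₀ lam mu nu)
    (hz : IsVdPCurveOn lam mu nu 1 (-1) (Ici t₀) z) (h0 : z t₀ ≠ 0) (T : ℝ) :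
    ∃ t ∈ Ici T, (z t).1 < 0 := by
  by_contra! hcon
  have hpos := H.pos_of_nonneg zero_le_one (le_max_left t₀ T) hz h0
    fun t ht => hcon t ((le_max_right t₀ T).trans ht)
  -- The shift by 1 moves from the open half-line of positivity to a closed one.
  have hlt : max t₀ T < max t₀ T + 1 := lt_add_one _
  exact H.false_of_pos hdiv hosc ((le_max_left t₀ T).trans hlt.le) hz
    fun t ht => hpos t (hlt.trans_le ht)

lemma isOscillatory (H : VdPCoeffs t₀ lam mu nu) (hdiv : DivergenceCondition t₀ lam mu nu)
    (hosc : OscillationCondition t₀ lam mu nu)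
    (hz : IsVdPCurveOn lam mu nu 1 (-1) (Ici t₀) z) (h0 : z t₀ ≠ 0) :
    IsOscillatory (fun t => (z t).1) := fun T => by
  refine ⟨H.exists_neg hdiv hosc hz h0 T, ?_⟩
  obtain ⟨t, ht, h⟩ := H.exists_neg hdiv hosc hz.neg (neg_ne_zero.2 h0) T
  exact ⟨t, ht, by simpa using h⟩

/-- A solution of the initial value problem agrees with the curve through the initial data. -/
lemma eqOn_of_isVdPSolutionOn (H : VdPCoeffs t₀ lam mu nu) {a b : ℝ} {I : Set ℝ} {ψ : ℝ → ℝ}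
    (hI : I ⊆ Ici t₀) (hIcc : ∀ t ∈ I, Icc t₀ t ⊆ I)
    (hz : IsVdPCurveOn lam mu nu 1 (-1) (Ici t₀) z) (hz0 : z t₀ = (a, lam t₀ * b))
    (hψ : IsVdPSolutionOn lam mu nu t₀ a b I ψ) : EqOn ψ (fun t => (z t).1) I := by
  obtain ⟨hsol, hψa, hψb⟩ := hψ
  have hw : IsVdPCurveOn lam mu nu 1 (-1) I (fun t => (ψ t, lam t * derivWithin ψ I t)) := by
    refine IsSolutionOn.isVdPCurveOn (fun t ht => H.lam_pos t (hI ht)) ?_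
    simpa [← sub_eq_add_neg] using hsol
  intro t ht
  have h := H.eqOn_of_eq_left zero_le_one (hw.mono (hIcc t ht)) (hz.mono Icc_subset_Ici_self)
    (by simp [hz0, hψa, hψb]) (right_mem_Icc.2 (hI ht))
  exact congrArg Prod.fst h

end VdPCoeffs

theorem theorem4p2 (t₀ : ℝ) (lam mu nu : ℝ → ℝ)
    (hlam_cont : ContinuousOn lam (Ici t₀))
    (hmu_cont : ContinuousOn mu (Ici t₀))
    (hnu_cont : ContinuousOn nu (Ici t₀))
    (hlam : ∀ t ∈ Ici t₀, 0 < lam t)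
    (hmu : ∀ t ∈ Ici t₀, 0 ≤ mu t)
    (hnu : ∀ t ∈ Ici t₀, 0 ≤ nu t) :
    ∀ a b : ℝ, ∃ φ : ℝ → ℝ,
      -- existence on the whole half-line
      IsVdPSolutionOn lam mu nu t₀ a b (Ici t₀) φ ∧
      -- uniqueness on the half-line
      (∀ ψ : ℝ → ℝ, IsVdPSolutionOn lam mu nu t₀ a b (Ici t₀) ψ → EqOn ψ φ (Ici t₀)) ∧
      -- every local solution of the initial value problem is a restriction of it
      (∀ T : ℝ, t₀ < T → ∀ ψ : ℝ → ℝ,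
        IsVdPSolutionOn lam mu nu t₀ a b (Ico t₀ T) ψ → EqOn ψ φ (Ico t₀ T)) ∧
      -- oscillation of the nontrivial solutions
      ((a ≠ 0 ∨ b ≠ 0) → DivergenceCondition t₀ lam mu nu →
        OscillationCondition t₀ lam mu nu → IsOscillatory φ) := by
  have H : VdPCoeffs t₀ lam mu nu := ⟨hlam_cont, hmu_cont, hnu_cont, hlam, hmu, hnu⟩
  intro a b
  have hl : lam t₀ ≠ 0 := (hlam t₀ self_mem_Ici).ne'
  obtain ⟨z, hz0, hz⟩ := H.exists_curve_Ici zero_le_one (-1) (a, lam t₀ * b)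
  refine ⟨fun t => (z t).1, ⟨?_, by simp [hz0], ?_⟩, fun ψ hψ => ?_, fun T _ ψ hψ => ?_,
    fun hab hdiv hosc => H.isOscillatory hdiv hosc hz fun h => ?_⟩
  · simpa [← sub_eq_add_neg] using hz.isSolutionOn (uniqueDiffOn_Ici t₀) hlam
  · rw [(hz.fst self_mem_Ici).derivWithin (uniqueDiffOn_Ici t₀ t₀ self_mem_Ici), hz0,
      mul_div_cancel_left₀ _ hl]
  · exact H.eqOn_of_isVdPSolutionOn Subset.rfl (fun _ _ => Icc_subset_Ici_self) hz hz0 hψ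
  · exact H.eqOn_of_isVdPSolutionOn Ico_subset_Ici_self
      (fun t ht s hs => ⟨hs.1, hs.2.trans_lt ht.2⟩) hz hz0 hψ
  · rw [hz0] at h
    have h1 := congrArg Prod.fst h
    have h2 := congrArg Prod.snd h
    simp only [Prod.fst_zero, Prod.snd_zero, mul_eq_zero, hl, false_or] at h1 h2
    exact hab.elim (· h1) (· h2)
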